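/- Let $G$ be a Polish group, i.e. a topological group whose topology is separable and induced by a complete metric. A subset $A$ of $G$ is universally measurable if for every Borel probability measure $\mu$ on $G$ it differs from a Borel set by a $\mu$-null set; a map from $G$ into a topological space is universally measurable if preimages of open sets are universally measurable. Let $S_\infty$ be the group of all permutations of $\mathbb{N}$ with the topology whose basic open sets are $\{g : g(n_i)=m_i,\ i\le k\}$, where $n_1,\dots,n_k,m_1,\dots,m_k\in\mathbb{N}$. Then: (1) Every universally measurable subgroup $F\leqslant G$ is either open in $G$ or has perfect index, meaning that there is a nonempty perfect set $C\subseteq G$ such that $xF\cap yF=\emptyset$ for all distinct $x,y\in C$. (2) Every universally measurable subgroup of countable (possibly finite) index in $G$ is open. (3) Every universally measurable group homomorphism $\pi\colon G\to S_\infty$ is continuous. -/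

import Mathlib

open MeasureTheory
open scoped Pointwise

/-- A subset `A` of a space with its Borel σ-algebra is universally measurable if for every Borel
probability measure `μ` it differs from a Borel set by a `μ`-null set. -/
def UniversallyMeasurableSet {X : Type*} [MeasurableSpace X] (A : Set X) : Prop :=
  ∀ μ : Measure X, IsProbabilityMeasure μ → NullMeasurableSet A μ

/-- A map is universally measurable if preimages of open sets are universally measurable. -/
def UniversallyMeasurableMap {X Y : Type*} [MeasurableSpace X] [TopologicalSpace Y]
    (f : X → Y) : Prop :=
  ∀ U : Set Y, IsOpen U → UniversallyMeasurableSet (f ⁻¹' U)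

/-- `A` admits a perfect set of disjoint left translates: there is a nonempty perfect set `C` such
that `x A` and `y A` are disjoint for all distinct `x, y ∈ C`. -/
def HasPerfectSetOfDisjointLeftTranslates {G : Type*} [Group G] [TopologicalSpace G]
    (A : Set G) : Prop :=
  ∃ C : Set G, C.Nonempty ∧ Perfect C ∧
    ∀ x ∈ C, ∀ y ∈ C, x ≠ y → Disjoint (x • A) (y • A)

/-- A subgroup has perfect index if it admits a perfect set of disjoint left translates. -/
def HasPerfectIndex {G : Type*} [Group G] [TopologicalSpace G] (F : Subgroup G) : Prop :=
  HasPerfectSetOfDisjointLeftTranslates (F : Set G)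

/-- The topology of `S_∞`, the group of all permutations of `ℕ`: the basic open sets are the sets
`{g | g n = m n for all n ∈ s}` for finite sets `s` of natural numbers and values `m n`. -/
instance permNatTopologicalSpace : TopologicalSpace (Equiv.Perm ℕ) :=
  TopologicalSpace.generateFrom
    {U | ∃ (s : Finset ℕ) (m : ℕ → ℕ), U = {g : Equiv.Perm ℕ | ∀ n ∈ s, g n = m n}}

/-! The proof rests on a dichotomy. Suppose no neighbourhood of 1 is covered by finitely many
conjugates of F. Then elements g_n → 1 can be chosen so fast and so generically that their products
over subsets of ℕ converge and define a continuous map φ from the Cantor group (ℤ/2)^ℕ to G for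
which flipping one coordinate always changes the coset of F. The preimage of a coset is disjoint
from its translates by the generators e_n → 0, hence Haar null by Steinhaus. By Fubini the relation
"φ(α) and φ(β) lie in the same coset" is null, and Mycielski's theorem yields a Cantor set meeting
each coset at most once: perfect index.

Otherwise a local form of Neumann's lemma turns the finitely many conjugates into finitely many
cosets of F covering a neighbourhood of 1. Then the closure K of F is open and F has finite index in
K. The normal core of F in K is a finite intersection of conjugates, so it is universally
measurable; if it were not open, φ would exhibit the Cantor group as a finite union of null sets. So
F is open.

Perfect index is uncountable, which gives (2); point stabilizers in S_∞ have countable index, which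
gives (3). -/

open Filter Topology Set

/-! ### Recursive choice of sequences -/

/-- Construction of a sequence by strong recursion, for relations `R n u b` that only depend on the
values of `u` below `n`. -/
theorem exists_seq_of_forall_extension {X : Type*} [Nonempty X] (R : ℕ → (ℕ → X) → X → Prop)
    (hcongr : ∀ n u v b, (∀ k < n, u k = v k) → R n u b → R n v b)
    (hext : ∀ n u, (∀ k < n, R k u (u k)) → ∃ b, R n u b) :
    ∃ u : ℕ → X, ∀ n, R n u (u n) := by
  classical
  let x₀ : X := Classical.arbitrary X
  -- Values from n on are replaced by a default; `hcongr` makes this harmless.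
  let F : ∀ n : ℕ, (∀ m : ℕ, m < n → X) → X := fun n f =>
    Classical.epsilon (R n (fun k => if h : k < n then f k h else x₀))
  let u : ℕ → X := fun n => Nat.lt_wfRel.wf.fix F n
  have hu : ∀ n, u n = Classical.epsilon (R n (fun k => if k < n then u k else x₀)) := by
    intro n
    have : u n = F n (fun m _ => u m) := Nat.lt_wfRel.wf.fix_eq F n
    rw [this]
    simp only [F, dite_eq_ite]
  refine ⟨u, fun n => ?_⟩
  induction n using Nat.strong_induction_on with
  | _ n ih =>
    obtain ⟨b, hb⟩ := hext n u ih
    have h1 : ∃ b, R n (fun k => if k < n then u k else x₀) b :=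
      ⟨b, hcongr n u _ b (fun k hk => by simp [hk]) hb⟩
    have h2 := Classical.epsilon_spec h1
    rw [← hu n] at h2
    exact hcongr n _ u _ (fun k hk => by simp [hk]) h2

/-! ### Density points on the line -/

/-- The sets of density one at `x` with respect to a measure on the real line, along the closed
balls of radius `1 / (n + 1)`. -/
noncomputable def densityFilter (ν : Measure ℝ) (x : ℝ) : Filter ℝ where
  sets := {A | Tendsto (fun n : ℕ => ν (Aᶜ ∩ Metric.closedBall x (1 / ((n : ℝ) + 1))) /
    ν (Metric.closedBall x (1 / ((n : ℝ) + 1)))) atTop (𝓝 0)}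
  univ_sets := by simp
  sets_of_superset := by
    intro A B hA hAB
    refine tendsto_of_tendsto_of_tendsto_of_le_of_le tendsto_const_nhds hA
      (fun n => zero_le) (fun n => ?_)
    dsimp only
    gcongr
  inter_sets := by
    intro A B hA hB
    have h := Tendsto.add hA hB
    rw [add_zero] at h
    refine tendsto_of_tendsto_of_tendsto_of_le_of_le tendsto_const_nhds h
      (fun n => zero_le) (fun n => ?_)
    dsimp only
    rw [← ENNReal.add_div]
    gcongr
    rw [compl_inter, union_inter_distrib_right]
    exact measure_union_le _ _

theorem mem_densityFilter {ν : Measure ℝ} {x : ℝ} {A : Set ℝ} :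
    A ∈ densityFilter ν x ↔
      Tendsto (fun n : ℕ => ν (Aᶜ ∩ Metric.closedBall x (1 / ((n : ℝ) + 1))) /
        ν (Metric.closedBall x (1 / ((n : ℝ) + 1)))) atTop (𝓝 0) := Iff.rfl

theorem densityFilter_le_nhds (ν : Measure ℝ) (x : ℝ) : densityFilter ν x ≤ 𝓝 x := by
  intro A hA
  rw [mem_densityFilter]
  obtain ⟨ε, hε, h⟩ := Metric.nhds_basis_closedBall.mem_iff.1 hA
  refine tendsto_const_nhds.congr' ?_
  have h1 : ∀ᶠ n : ℕ in atTop, (1 / ((n : ℝ) + 1)) < ε :=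
    tendsto_one_div_add_atTop_nhds_zero_nat.eventually_lt_const hε
  filter_upwards [h1] with n hn
  have : Aᶜ ∩ Metric.closedBall x (1 / ((n : ℝ) + 1)) = ∅ := by
    rw [← disjoint_iff_inter_eq_empty, disjoint_compl_left_iff_subset]
    exact (Metric.closedBall_subset_closedBall hn.le).trans h
  rw [this]; simp

theorem densityFilter_le_ae (ν : Measure ℝ) (x : ℝ) : densityFilter ν x ≤ ae ν := by
  intro A hA
  rw [mem_densityFilter]
  refine tendsto_const_nhds.congr fun n => ?_
  rw [measure_mono_null inter_subset_left (mem_ae_iff.1 hA)]; simp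

theorem tendsto_one_div_add_nhdsGT_zero :
    Tendsto (fun n : ℕ => 1 / ((n : ℝ) + 1)) atTop (𝓝[>] 0) :=
  tendsto_nhdsWithin_iff.2 ⟨tendsto_one_div_add_atTop_nhds_zero_nat,
    Eventually.of_forall fun n => by simp only [mem_Ioi]; positivity⟩

/-- Besicovitch's covering theorem gives Lebesgue density for any finite measure on the line, which
is why Mycielski's theorem is proved there first. -/
theorem ae_mem_densityFilter (ν : Measure ℝ) [IsFiniteMeasure ν] {A : Set ℝ}
    (hA : MeasurableSet A) : ∀ᵐ x ∂ν, x ∈ A → A ∈ densityFilter ν x := by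
  filter_upwards [Besicovitch.ae_tendsto_measure_inter_div_of_measurableSet ν hA.compl] with x hx hxA
  rw [mem_densityFilter]
  have := hx.comp tendsto_one_div_add_nhdsGT_zero
  simpa [hxA, Function.comp_def] using this

/-- Off the support of `ν` the ratio is 0 / 0 = 0 and the filter is improper; at density points of
the whole line the ratio tends to 1, so the empty set is excluded. -/
theorem ae_neBot_densityFilter (ν : Measure ℝ) [IsFiniteMeasure ν] :
    ∀ᵐ x ∂ν, (densityFilter ν x).NeBot := by
  filter_upwards [Besicovitch.ae_tendsto_measure_inter_div_of_measurableSet ν MeasurableSet.univ]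
    with x hx
  refine ⟨fun h => ?_⟩
  have h0 : (∅ : Set ℝ) ∈ densityFilter ν x := h ▸ mem_bot
  rw [mem_densityFilter] at h0
  have h1 := hx.comp tendsto_one_div_add_nhdsGT_zero
  have h2 := tendsto_nhds_unique (by simpa [Function.comp_def] using h0) h1
  simp at h2

/-- This is the measurability needed to exchange two almost-everywhere quantifiers by Fubini. -/
theorem measurableSet_section_mem_densityFilter (ν : Measure ℝ) [IsFiniteMeasure ν]
    {K : Set (ℝ × ℝ)} (hK : MeasurableSet K) :
    MeasurableSet {p : ℝ × ℝ | {z | (z, p.2) ∈ K} ∈ densityFilter ν p.1} := by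
  simp only [mem_densityFilter]
  have hd : Measurable fun q : (ℝ × ℝ) × ℝ => dist q.2 q.1.1 := by fun_prop
  refine measurableSet_tendsto _ fun n => Measurable.div ?_ ?_
  · have hS : MeasurableSet {q : (ℝ × ℝ) × ℝ |
        (q.2, q.1.2) ∈ Kᶜ ∧ dist q.2 q.1.1 ≤ 1 / ((n : ℝ) + 1)} := by
      refine MeasurableSet.inter ?_ ?_
      · exact (measurable_snd.prodMk (measurable_snd.comp measurable_fst)) hK.compl
      · exact measurableSet_le hd measurable_const
    exact measurable_measure_prodMk_left hS
  · have hS : MeasurableSet {q : (ℝ × ℝ) × ℝ | dist q.2 q.1.1 ≤ 1 / ((n : ℝ) + 1)} :=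
      measurableSet_le hd measurable_const
    exact measurable_measure_prodMk_left hS

/-- Outer regularity encloses E in open sets of measure tending to 0. Finite intersections make them
decrease, and intersecting the complements with their mirror images makes these symmetric. -/
theorem exists_monotone_isClosed_of_measure_prod_eq_zero {X : Type*} [TopologicalSpace X]
    [PolishSpace X]
    [MeasurableSpace X] [BorelSpace X] (ν : Measure X) [IsFiniteMeasure ν] {E : Set (X × X)}
    (hE : (ν.prod ν) E = 0) :
    ∃ K : ℕ → Set (X × X), Monotone K ∧ (∀ j, IsClosed (K j)) ∧
      (∀ j x y, (x, y) ∈ K j → (y, x) ∈ K j) ∧ (∀ j, Disjoint (K j) E) ∧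
      ∀ᵐ p ∂(ν.prod ν), ∃ j, p ∈ K j := by
  let _ := TopologicalSpace.upgradeIsCompletelyMetrizable X
  have hU : ∀ j : ℕ, ∃ U ⊇ E, IsOpen U ∧ (ν.prod ν) U < ((j : ENNReal) + 1)⁻¹ := fun j =>
    E.exists_isOpen_lt_of_lt _ (by rw [hE]; simp)
  choose U hEU hUo hUlt using hU
  let V : ℕ → Set (X × X) := fun j => ⋂ i ∈ Finset.range (j + 1), U i
  have hVo : ∀ j, IsOpen (V j) := fun j => isOpen_biInter_finset fun i _ => hUo i
  have hVU : ∀ j, V j ⊆ U j := fun j => biInter_subset_of_mem (by simp)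
  have hVanti : Antitone V := fun i j hij => biInter_subset_biInter_left (by
    intro k hk; simp at hk ⊢; omega)
  refine ⟨fun j => (V j)ᶜ ∩ Prod.swap ⁻¹' (V j)ᶜ, ?_, ?_, ?_, ?_, ?_⟩
  · intro i j hij
    have := compl_subset_compl.2 (hVanti hij)
    exact inter_subset_inter this (preimage_mono this)
  · exact fun j => (hVo j).isClosed_compl.inter ((hVo j).isClosed_compl.preimage continuous_swap)
  · rintro j x y ⟨h1, h2⟩
    exact ⟨h2, h1⟩
  · intro j
    refine Disjoint.mono_left inter_subset_left (disjoint_compl_left_iff_subset.2 ?_)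
    exact subset_iInter₂ fun i _ => hEU i
  · rw [ae_iff]
    have hle : ∀ j : ℕ, (ν.prod ν) {p | ¬ ∃ j, p ∈ (V j)ᶜ ∩ Prod.swap ⁻¹' (V j)ᶜ}
        ≤ ((j : ENNReal) + 1)⁻¹ + ((j : ENNReal) + 1)⁻¹ := by
      intro j
      have hsub : {p | ¬ ∃ j, p ∈ (V j)ᶜ ∩ Prod.swap ⁻¹' (V j)ᶜ} ⊆ U j ∪ Prod.swap ⁻¹' (U j) := by
        intro p hp
        simp only [not_exists, mem_ofPred_eq, mem_inter_iff, not_and_or] at hp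
        rcases hp j with h | h
        · exact Or.inl (hVU j (not_not.1 h))
        · exact Or.inr (hVU j (not_not.1 h))
      refine (measure_mono hsub).trans ((measure_union_le _ _).trans ?_)
      have : (ν.prod ν) (Prod.swap ⁻¹' (U j)) = (ν.prod ν) (U j) :=
        (Measure.measurePreserving_swap (μ := ν) (ν := ν)).measure_preimage
          (hUo j).measurableSet.nullMeasurableSet
      rw [this]
      exact add_le_add (hUlt j).le (hUlt j).le
    have hlim : Tendsto (fun j : ℕ => ((j : ENNReal) + 1)⁻¹ + ((j : ENNReal) + 1)⁻¹) atTop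
        (𝓝 (0 + 0)) := by
      have : Tendsto (fun j : ℕ => ((j : ENNReal) + 1)⁻¹) atTop (𝓝 0) := by
        have := (tendsto_add_atTop_iff_nat 1).2 ENNReal.tendsto_inv_nat_nhds_zero
        simpa using this
      exact this.add this
    rw [add_zero] at hlim
    exact le_antisymm (ge_of_tendsto' hlim hle) zero_le

/-! ### Cantor schemes -/

/-- The natural number whose binary digits are the first `m` terms of `α`. -/
def binaryPrefix (α : ℕ → Bool) : ℕ → ℕ
  | 0 => 0
  | m + 1 => binaryPrefix α m + if α m then 2 ^ m else 0

theorem binaryPrefix_lt (α : ℕ → Bool) (m : ℕ) : binaryPrefix α m < 2 ^ m := by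
  induction m with
  | zero => simp [binaryPrefix]
  | succ m ih => rw [binaryPrefix, pow_succ]; split_ifs <;> omega

theorem continuous_binaryPrefix (m : ℕ) : Continuous fun α => binaryPrefix α m := by
  induction m with
  | zero => exact continuous_const
  | succ m ih =>
    have : Continuous fun b : Bool => if b then 2 ^ m else 0 := continuous_of_discreteTopology
    exact ih.add (this.comp (continuous_apply m))

theorem binaryPrefix_congr {α β : ℕ → Bool} {m : ℕ} (h : ∀ k < m, α k = β k) :
    binaryPrefix α m = binaryPrefix β m := by
  induction m with
  | zero => rfl
  | succ m ih => rw [binaryPrefix, binaryPrefix, ih fun k hk => h k (by omega), h m (by omega)]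

theorem log_add_two_pow {a l : ℕ} (h : a < 2 ^ l) : Nat.log 2 (a + 2 ^ l) = l :=
  (Nat.log_eq_iff (Or.inr ⟨by norm_num, by positivity⟩)).2 ⟨by omega, by rw [pow_succ]; omega⟩

/-- A Cantor scheme: if finitely many points of `Z` that are pairwise in good position can always be
extended by a new point close to a given one of them, then there is a Cantor set of points pairwise
in the closed sets `K j`. -/
theorem exists_continuous_of_forall_extension {X : Type*} [MetricSpace X] [CompleteSpace X]
    (K : ℕ → Set (X × X)) (hK : ∀ j, IsClosed (K j)) (Good : ℕ → X → X → Prop)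
    (hsymm : ∀ j x y, Good j x y → Good j y x) (hGK : ∀ j x y, Good j x y → (x, y) ∈ K j)
    (Z : Set X) (hZ : Z.Nonempty)
    (hext : ∀ x ∈ Z, ∀ T : Finset X, (T : Set X) ⊆ Z → (∀ y ∈ T, ∃ j, Good j x y) → ∀ ε > 0,
      ∃ b ∈ Z, dist b x < ε ∧ (∀ y ∈ T, ∀ j, Good j x y → Good j b y) ∧ ∃ j, Good j x b) :
    ∃ f : (ℕ → Bool) → X, Continuous f ∧ ∀ α β, α ≠ β → ∃ j, (f α, f β) ∈ K j := by
  classical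
  obtain ⟨z, hz⟩ := hZ
  have : Nonempty X := ⟨z⟩
  -- The parent of n, obtained by deleting its leading binary digit. Level l adds a child a + 2 ^ l
  -- to every a < 2 ^ l.
  let p : ℕ → ℕ := fun n => n - 2 ^ Nat.log 2 n
  have hp : ∀ n, 0 < n → p n < n := fun n hn => Nat.sub_lt hn (by positivity)
  have hp2 : ∀ a l, a < 2 ^ l → p (a + 2 ^ l) = a := by
    intro a l h
    simp only [p, log_add_two_pow h]; omega
  -- A new point is close to its parent, inherits the parent's good relations at the same index j,
  -- and is good with the parent at some index.
  let R : ℕ → (ℕ → X) → X → Prop := fun n u b => b ∈ Z ∧ (0 < n →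
    dist b (u (p n)) < (1 / 2 : ℝ) ^ Nat.log 2 n ∧
    (∀ a < n, a ≠ p n → ∀ j, Good j (u (p n)) (u a) → Good j b (u a)) ∧ ∃ j, Good j (u (p n)) b)
  have hpair : ∀ (u : ℕ → X) m, (∀ k < m, R k u (u k)) → ∀ a < m, ∀ b < a,
      ∃ j, Good j (u a) (u b) := by
    intro u m hu a
    induction a using Nat.strong_induction_on with
    | _ a ih =>
      intro ha b hb
      obtain ⟨-, h⟩ := hu a ha
      obtain ⟨-, h2, j, h3⟩ := h (by omega)
      have hpa := hp a (by omega)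
      by_cases hba : b = p a
      · subst hba
        exact ⟨j, hsymm _ _ _ h3⟩
      · rcases lt_or_gt_of_ne hba with h4 | h4
        · obtain ⟨i, hi⟩ := ih (p a) hpa (by omega) b h4
          exact ⟨i, h2 b hb hba i hi⟩
        · obtain ⟨i, hi⟩ := ih b hb (by omega) (p a) h4
          exact ⟨i, h2 b hb hba i (hsymm _ _ _ hi)⟩
  obtain ⟨u, hu⟩ : ∃ u : ℕ → X, ∀ n, R n u (u n) := by
    refine exists_seq_of_forall_extension R ?_ ?_
    · intro n u v b huv hR
      refine ⟨hR.1, fun hn => ?_⟩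
      obtain ⟨h1, h2, h3⟩ := hR.2 hn
      rw [huv _ (hp n hn)] at h1 h2 h3
      refine ⟨h1, fun a ha hap j hj => ?_, h3⟩
      rw [← huv a ha] at hj ⊢
      exact h2 a ha hap j hj
    · intro n u hR
      rcases Nat.eq_zero_or_pos n with rfl | hn
      · exact ⟨z, hz, fun h => absurd h (lt_irrefl _)⟩
      · obtain ⟨b, hb, h1, h2, h3⟩ := hext (u (p n)) (hR _ (hp n hn)).1
          (((Finset.range n).erase (p n)).image u) (by
            intro y hy
            simp only [Finset.coe_image, mem_image, Finset.mem_coe, Finset.mem_erase,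
              Finset.mem_range] at hy
            obtain ⟨a, ⟨-, ha⟩, rfl⟩ := hy
            exact (hR a ha).1) (by
            intro y hy
            simp only [Finset.mem_image, Finset.mem_erase, Finset.mem_range] at hy
            obtain ⟨a, ⟨hap, ha⟩, rfl⟩ := hy
            rcases lt_or_gt_of_ne hap with h | h
            · exact hpair u n hR _ (hp n hn) _ h
            · obtain ⟨j, hj⟩ := hpair u n hR _ ha _ h
              exact ⟨j, hsymm _ _ _ hj⟩)
          ((1 / 2 : ℝ) ^ Nat.log 2 n) (by positivity)
        refine ⟨b, hb, fun _ => ⟨h1, fun a ha hap => h2 _ ?_, h3⟩⟩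
        simp only [Finset.mem_image, Finset.mem_erase, Finset.mem_range]
        exact ⟨a, ⟨hap, ha⟩, rfl⟩
  have hnew : ∀ l a, a < 2 ^ l → dist (u (a + 2 ^ l)) (u a) < (1 / 2 : ℝ) ^ l ∧
      (∀ b < a + 2 ^ l, b ≠ a → ∀ j, Good j (u a) (u b) → Good j (u (a + 2 ^ l)) (u b)) ∧
      ∃ j, Good j (u a) (u (a + 2 ^ l)) := by
    intro l a ha
    have := (hu (a + 2 ^ l)).2 (by positivity)
    rwa [hp2 a l ha, log_add_two_pow ha] at this
  have hstep : ∀ (α : ℕ → Bool) m,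
      dist (u (binaryPrefix α m)) (u (binaryPrefix α (m + 1))) ≤ 1 * (1 / 2 : ℝ) ^ m := by
    intro α m
    rw [binaryPrefix, one_mul]
    split_ifs
    · rw [dist_comm]; exact (hnew m _ (binaryPrefix_lt α m)).1.le
    · simp
  have hlim : ∀ α : ℕ → Bool, ∃ x, Tendsto (fun m => u (binaryPrefix α m)) atTop (𝓝 x) := fun α =>
    cauchySeq_tendsto_of_complete (cauchySeq_of_le_geometric _ _ (by norm_num) (hstep α))
  choose f hf using hlim
  refine ⟨f, ?_, ?_⟩
  · have hunif : TendstoUniformly (fun m α => u (binaryPrefix α m)) f atTop := by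
      rw [Metric.tendstoUniformly_iff]
      intro ε hε
      have h1 : Tendsto (fun m : ℕ => 1 * (1 / 2 : ℝ) ^ m / (1 - 1 / 2)) atTop (𝓝 0) := by
        have := ((tendsto_pow_atTop_nhds_zero_of_lt_one (r := (1 / 2 : ℝ)) (by norm_num)
          (by norm_num)).const_mul 1).div_const (1 - 1 / 2)
        simpa using this
      filter_upwards [h1.eventually_lt_const hε] with m hm α
      rw [dist_comm]
      exact (dist_le_of_le_geometric_of_tendsto _ _ (by norm_num) (hstep α) (hf α) m).trans_lt hm
    refine hunif.continuous (Frequently.of_forall fun m => ?_)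
    exact (continuous_of_discreteTopology (f := u)).comp (continuous_binaryPrefix m)
  · intro α β hαβ
    have hex : ∃ m, α m ≠ β m := Function.ne_iff.1 hαβ
    let m := Nat.find hex
    have hm : α m ≠ β m := Nat.find_spec hex
    have heq : binaryPrefix α m = binaryPrefix β m :=
      binaryPrefix_congr fun k hk => not_not.1 (Nat.find_min hex hk)
    -- At the first difference of α and β, one prefix is the parent of the other.
    have hbase : ∃ j, binaryPrefix α (m + 1) ≠ binaryPrefix β (m + 1) ∧
        Good j (u (binaryPrefix α (m + 1))) (u (binaryPrefix β (m + 1))) := by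
      obtain ⟨-, -, j, hj⟩ := hnew m _ (binaryPrefix_lt β m)
      have h2 : 0 < 2 ^ m := by positivity
      simp only [binaryPrefix, heq]
      refine ⟨j, ?_⟩
      cases hα : α m <;> cases hβ : β m <;> simp_all
    obtain ⟨j, hj⟩ := hbase
    refine ⟨j, ?_⟩
    -- The index j stays fixed from here on, so the limit pair remains in the single closed set `K
    -- j`.
    have hall : ∀ l, m + 1 ≤ l → binaryPrefix α l ≠ binaryPrefix β l ∧
        Good j (u (binaryPrefix α l)) (u (binaryPrefix β l)) := by
      intro l hl
      induction l, hl using Nat.le_induction with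
      | base => exact hj
      | succ l hl ih =>
        have key : ∀ a b, a < 2 ^ l → b < 2 ^ l → a ≠ b → Good j (u a) (u b) →
            Good j (u (a + 2 ^ l)) (u b) := fun a b ha hb hab h =>
          (hnew l a ha).2.1 b (by omega) hab.symm j h
        -- When both points move, the smaller index moves first, since a child inherits relations
        -- only to points of smaller index.
        have key2 : ∀ a b, a < 2 ^ l → b < 2 ^ l → a < b → Good j (u a) (u b) →
            Good j (u (b + 2 ^ l)) (u (a + 2 ^ l)) := fun a b ha hb hab h =>
          (hnew l b hb).2.1 (a + 2 ^ l) (by omega) (by omega) j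
            (hsymm _ _ _ (key a b ha hb hab.ne h))
        obtain ⟨hne, hg⟩ := ih
        have ha := binaryPrefix_lt α l
        have hb := binaryPrefix_lt β l
        simp only [binaryPrefix]
        generalize binaryPrefix α l = a at *
        generalize binaryPrefix β l = b at *
        split_ifs
        · refine ⟨by omega, ?_⟩
          rcases lt_or_gt_of_ne hne with h | h
          · exact hsymm _ _ _ (key2 a b ha hb h hg)
          · exact key2 b a hb ha h (hsymm _ _ _ hg)
        · exact ⟨by omega, key a b ha hb hne hg⟩
        · exact ⟨by omega, hsymm _ _ _ (key b a hb ha hne.symm (hsymm _ _ _ hg))⟩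
        · exact ⟨by omega, hg⟩
    exact (hK j).mem_of_tendsto ((hf α).prodMk_nhds (hf β))
      ((eventually_ge_atTop (m + 1)).mono fun l hl => hGK _ _ _ (hall l hl).2)

/-! ### Mycielski's theorem for measures -/

/-- **Mycielski's theorem** for a finite measure on the real line: a null set in the plane is avoided
by all pairs of distinct points of some Cantor set. -/
theorem exists_continuous_avoiding_of_measure_prod_eq_zero_real (ν : Measure ℝ) [IsFiniteMeasure ν]
    (hν : ν ≠ 0) {E : Set (ℝ × ℝ)} (hE : (ν.prod ν) E = 0) :
    ∃ f : (ℕ → Bool) → ℝ, Continuous f ∧ ∀ α β, α ≠ β → (f α, f β) ∉ E := by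
  obtain ⟨K, hmono, hcl, hsymm, hdisj, hae⟩ := exists_monotone_isClosed_of_measure_prod_eq_zero ν hE
  have hKm : ∀ j, MeasurableSet (K j) := fun j => (hcl j).measurableSet
  have hsec : ∀ j y, MeasurableSet {z | (z, y) ∈ K j} := fun j y =>
    (hKm j).preimage measurable_prodMk_right
  -- The density conditions make goodness persist: almost every b near x, in the sense of density,
  -- can replace x.
  let Good : ℕ → ℝ → ℝ → Prop := fun j x y =>
    (x, y) ∈ K j ∧ {z | (z, y) ∈ K j} ∈ densityFilter ν x ∧ {z | (z, x) ∈ K j} ∈ densityFilter ν y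
  have hdens : ∀ j y, ∀ᵐ x ∂ν, (x, y) ∈ K j → {z | (z, y) ∈ K j} ∈ densityFilter ν x := fun j y =>
    ae_mem_densityFilter ν (hsec j y)
  have hdens2 : ∀ j, ∀ᵐ x ∂ν, ∀ᵐ b ∂ν,
      (x, b) ∈ K j → {z | (z, b) ∈ K j} ∈ densityFilter ν x := by
    intro j
    have hm : MeasurableSet {p : ℝ × ℝ |
        p ∈ K j → {z | (z, p.2) ∈ K j} ∈ densityFilter ν p.1} := by
      have := (hKm j).compl.union (measurableSet_section_mem_densityFilter ν (hKm j))
      convert this using 1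
      ext p
      simp [imp_iff_not_or]
    exact (Measure.ae_ae_comm (p := fun x b => (x, b) ∈ K j →
      {z | (z, b) ∈ K j} ∈ densityFilter ν x) hm).2 (Eventually.of_forall fun y => hdens j y)
  let Z : Set ℝ := {x | (densityFilter ν x).NeBot ∧ (∀ᵐ b ∂ν, ∃ j, (x, b) ∈ K j) ∧
    ∀ j, ∀ᵐ b ∂ν, (x, b) ∈ K j → {z | (z, b) ∈ K j} ∈ densityFilter ν x}
  have hZae : ∀ᵐ x ∂ν, x ∈ Z := by
    filter_upwards [ae_neBot_densityFilter ν, Measure.ae_ae_of_ae_prod hae, ae_all_iff.2 hdens2]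
      with x h1 h2 h3 using ⟨h1, h2, h3⟩
  have hnb : (ae ν).NeBot := ae_neBot.2 hν
  have hGmono : ∀ i j x y, i ≤ j → Good i x y → Good j x y := by
    rintro i j x y hij ⟨h1, h2, h3⟩
    exact ⟨hmono hij h1, mem_of_superset h2 fun z hz => hmono hij hz,
      mem_of_superset h3 fun z hz => hmono hij hz⟩
  have hext1 : ∀ y ∈ Z, ∀ j x, Good j x y → ∀ᶠ b in densityFilter ν x, Good j b y := by
    intro y hy j x hg
    filter_upwards [hg.2.1, densityFilter_le_ae ν x (hdens j y), densityFilter_le_ae ν x (hy.2.2 j)]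
      with b h1 h2 h3
    exact ⟨h1, h2 h1, h3 (hsymm _ _ _ h1)⟩
  obtain ⟨f, hf, hfK⟩ := exists_continuous_of_forall_extension K hcl Good
    (fun j x y h => ⟨hsymm _ _ _ h.1, h.2.2, h.2.1⟩) (fun j x y h => h.1) Z hZae.exists (by
      intro x hx T hTZ hT ε hε
      have hnbx := hx.1
      have hlast : ∀ᶠ b in densityFilter ν x, ∃ j, Good j x b := by
        have h1 := ae_all_iff.2 fun j => hdens j x
        filter_upwards [densityFilter_le_ae ν x hx.2.1, densityFilter_le_ae ν x h1,
          densityFilter_le_ae ν x (ae_all_iff.2 hx.2.2)] with b ⟨j, hj⟩ h2 h3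
        exact ⟨j, hj, h3 j hj, h2 j (hsymm _ _ _ hj)⟩
      -- Only the least j for each y needs attention, because `Good` is monotone in j.
      have hmid : ∀ᶠ b in densityFilter ν x, ∀ y ∈ T, ∀ j, Good j x y → Good j b y := by
        rw [Filter.eventually_all_finset]
        intro y hy
        classical
        have hex := hT y hy
        filter_upwards [hext1 y (hTZ hy) (Nat.find hex) x (Nat.find_spec hex)] with b hb j hj
        exact hGmono _ _ _ _ (Nat.find_min' hex hj) hb
      have hdist : ∀ᶠ b in densityFilter ν x, dist b x < ε :=
        densityFilter_le_nhds ν x (Metric.ball_mem_nhds x hε)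
      have hZx : ∀ᶠ b in densityFilter ν x, b ∈ Z := densityFilter_le_ae ν x hZae
      obtain ⟨b, h1, h2, h3, h4⟩ :=
        (hZx.and (hdist.and (hmid.and hlast))).exists
      exact ⟨b, h1, h2, h3, h4⟩)
  refine ⟨f, hf, fun α β h hmem => ?_⟩
  obtain ⟨j, hj⟩ := hfK α β h
  exact disjoint_left.1 (hdisj j) hj hmem

/-- **Mycielski's theorem** for a finite measure on a space embedded in the real line. -/
theorem exists_continuous_avoiding_of_measure_prod_eq_zero {Ω : Type*} [TopologicalSpace Ω]
    [MeasurableSpace Ω] [BorelSpace Ω] {e : Ω → ℝ} (he : IsClosedEmbedding e)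
    (μ : Measure Ω) [IsFiniteMeasure μ] (hμ : μ ≠ 0) {E : Set (Ω × Ω)} (hE : (μ.prod μ) E = 0) :
    ∃ f : (ℕ → Bool) → Ω, Continuous f ∧ ∀ α β, α ≠ β → (f α, f β) ∉ E := by
  have hem := he.measurableEmbedding
  have hee : MeasurableEmbedding (Prod.map e e) := hem.prodMap hem
  -- The avoided set includes every pair outside the range of e × e, so f is forced into the range
  -- of e.
  obtain ⟨f, hf, hfE⟩ := exists_continuous_avoiding_of_measure_prod_eq_zero_real (μ.map e)
    (by rwa [Ne, Measure.map_eq_zero_iff hem.measurable.aemeasurable])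
    (E := (Prod.map e e '' Eᶜ)ᶜ) (by
      rw [Measure.map_prod_map _ _ hem.measurable hem.measurable, hee.map_apply, preimage_compl,
        preimage_image_eq _ hee.injective, compl_compl, hE])
  have hex : ∀ α β, α ≠ β → ∃ a b, e a = f α ∧ e b = f β ∧ (a, b) ∉ E := by
    intro α β h
    obtain ⟨⟨a, b⟩, hab, h⟩ := not_not.1 (hfE α β h)
    exact ⟨a, b, congrArg Prod.fst h, congrArg Prod.snd h, hab⟩
  have hex1 : ∀ α, ∃ a, e a = f α := by
    intro α
    obtain ⟨β, hβ⟩ := exists_ne α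
    obtain ⟨a, b, h, -⟩ := hex α β hβ.symm
    exact ⟨a, h⟩
  choose g hg using hex1
  refine ⟨g, ?_, fun α β h => ?_⟩
  · rw [he.isInducing.continuous_iff]
    exact (funext hg : e ∘ g = f) ▸ hf
  · obtain ⟨a, b, h1, h2, h3⟩ := hex α β h
    rw [← hg α] at h1
    rw [← hg β] at h2
    rwa [← he.injective h1, ← he.injective h2]

/-! ### The Cantor group and its null sets -/

theorem exists_isClosedEmbedding_cantor_real : ∃ e : (ℕ → ZMod 2) → ℝ, IsClosedEmbedding e := by
  have c : ZMod 2 ≃ Bool := Fintype.equivOfCardEq (by simp [ZMod.card])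
  let h : ZMod 2 ≃ₜ Bool :=
    ⟨c, continuous_of_discreteTopology, continuous_of_discreteTopology⟩
  let H : (ℕ → ZMod 2) ≃ₜ cantorSet :=
    (Homeomorph.piCongrRight fun _ => h).trans cantorSetHomeomorphNatToBool.symm
  exact ⟨fun x => H x, (continuous_subtype_val.comp H.continuous).isClosedEmbedding
    (Subtype.val_injective.comp H.injective)⟩

/-- A measurable set of the Cantor group that is disjoint from its translates by the standard
generators is null. -/
theorem addHaar_eq_zero_of_forall_add_single_notMem (μ : Measure (ℕ → ZMod 2))
    [μ.IsAddHaarMeasure] {A : Set (ℕ → ZMod 2)} (hA : NullMeasurableSet A μ)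
    (h : ∀ a ∈ A, ∀ n, a + Pi.single n 1 ∉ A) : μ A = 0 := by
  obtain ⟨B, hBA, hB, hBe⟩ := hA.exists_measurable_subset_ae_eq
  rw [← measure_congr hBe]
  by_contra hne
  -- Steinhaus: B - B is a neighbourhood of 0, so it contains a generator e_n for large n.
  have h0 := Measure.sub_mem_nhds_zero_of_addHaar_pos μ B hB (pos_iff_ne_zero.2 hne)
  have hlim : Tendsto (fun n : ℕ => (Pi.single n 1 : ℕ → ZMod 2)) atTop (𝓝 0) := by
    rw [tendsto_pi_nhds]
    intro k
    refine tendsto_const_nhds.congr' ?_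
    filter_upwards [eventually_gt_atTop k] with n hn
    rw [Pi.single_eq_of_ne hn.ne]; rfl
  obtain ⟨n, hn⟩ := (hlim.eventually h0).exists
  obtain ⟨b, hb, a, ha, hab⟩ := hn
  refine h a (hBA ha) n ?_
  rw [← hab]
  simpa using hBA hb

/-! ### Mapping the Cantor group into G -/

/-- The product `g (m - 1) ^ α (m - 1) * ⋯ * g 0 ^ α 0`. -/
def partialProduct {G : Type*} [Group G] (g : ℕ → G) (α : ℕ → ZMod 2) : ℕ → G
  | 0 => 1
  | m + 1 => (if α m = 0 then 1 else g m) * partialProduct g α m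

section

variable {G : Type*} [Group G]

theorem partialProduct_congr {g h : ℕ → G} {α β : ℕ → ZMod 2} {m : ℕ} (hgh : ∀ k < m, g k = h k)
    (hαβ : ∀ k < m, α k = β k) : partialProduct g α m = partialProduct h β m := by
  induction m with
  | zero => rfl
  | succ m ih =>
    rw [partialProduct, partialProduct, ih (fun k hk => hgh k (by omega)) fun k hk =>
      hαβ k (by omega), hgh m (by omega), hαβ m (by omega)]

theorem finite_range_partialProduct (g : ℕ → G) (m : ℕ) :
    (range fun α => partialProduct g α m).Finite := by
  induction m with
  | zero => exact (finite_singleton 1).subset (by rintro _ ⟨α, rfl⟩; rfl)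
  | succ m ih =>
    refine (((finite_singleton (g m)).insert 1).mul ih).subset ?_
    rintro _ ⟨α, rfl⟩
    refine mul_mem_mul ?_ ⟨α, rfl⟩
    split_ifs <;> simp

theorem continuous_partialProduct [TopologicalSpace G] [ContinuousMul G] (g : ℕ → G) (m : ℕ) :
    Continuous fun α => partialProduct g α m := by
  induction m with
  | zero => exact continuous_const
  | succ m ih =>
    have : Continuous fun a : ZMod 2 => if a = 0 then 1 else g m := continuous_of_discreteTopology
    exact (this.comp (continuous_apply m)).mul ih

/-- New factors enter on the left, so all factors after the n-th cancel in the quotient and a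
conjugate of `g n` by an earlier partial product remains. -/
theorem inv_partialProduct_mul_partialProduct_add_single (g : ℕ → G) {α : ℕ → ZMod 2} {n : ℕ}
    (hα : α n = 0) {k : ℕ} (hk : n + 1 ≤ k) :
    (partialProduct g α k)⁻¹ * partialProduct g (α + Pi.single n 1) k =
      (partialProduct g α n)⁻¹ * g n * partialProduct g α n := by
  induction k, hk using Nat.le_induction with
  | base =>
    have : partialProduct g (α + Pi.single n 1) n = partialProduct g α n :=
      partialProduct_congr (fun _ _ => rfl) fun k hk => by simp [Pi.single_eq_of_ne hk.ne]
    simp [partialProduct, hα, this, mul_assoc]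
  | succ k hk ih =>
    have : (α + Pi.single n 1 : ℕ → ZMod 2) k = α k := by simp [Pi.single_eq_of_ne (show k ≠ n by omega)]
    rw [partialProduct, partialProduct, this, ← ih]
    group

/-- If no neighbourhood of the identity is covered by finitely many conjugates of `F`, then the Cantor
group maps continuously to `G` in such a way that changing one coordinate changes the coset
of `F`. -/
theorem exists_continuous_forall_inv_mul_add_single_notMem [TopologicalSpace G]
    [IsTopologicalGroup G] [PolishSpace G] (F : Subgroup G)
    (hF : ∀ S : Finset G, ∀ U ∈ 𝓝 (1 : G), ∃ g ∈ U, ∀ s ∈ S, s⁻¹ * g * s ∉ F) :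
    ∃ φ : (ℕ → ZMod 2) → G, Continuous φ ∧ ∀ α n, (φ α)⁻¹ * φ (α + Pi.single n 1) ∉ F := by
  let _ := TopologicalSpace.upgradeIsCompletelyMetrizable G
  obtain ⟨g, hg⟩ : ∃ g : ℕ → G, ∀ n, ∀ α : ℕ → ZMod 2,
      dist (partialProduct g α n) (g n * partialProduct g α n) < (1 / 2 : ℝ) ^ n ∧
      (partialProduct g α n)⁻¹ * g n * partialProduct g α n ∉ F := by
    refine exists_seq_of_forall_extension (fun n u b => ∀ α : ℕ → ZMod 2,
      dist (partialProduct u α n) (b * partialProduct u α n) < (1 / 2 : ℝ) ^ n ∧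
      (partialProduct u α n)⁻¹ * b * partialProduct u α n ∉ F) ?_ ?_
    · intro n u v b huv h α
      rw [← partialProduct_congr huv fun _ _ => rfl]
      exact h α
    · intro n u _
      -- Only finitely many partial products occur at stage n, so one choice of b serves all α.
      have hfin := finite_range_partialProduct u n
      obtain ⟨b, hb, hbF⟩ := hF hfin.toFinset
        (⋂ s ∈ hfin.toFinset, {b | dist s (b * s) < (1 / 2 : ℝ) ^ n}) (by
          rw [biInter_finset_mem]
          intro s _
          have hc : Continuous fun b : G => dist s (b * s) := by fun_prop
          exact (isOpen_lt hc continuous_const).mem_nhds (by simp))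
      refine ⟨b, fun α => ?_⟩
      have hmem : partialProduct u α n ∈ hfin.toFinset := hfin.mem_toFinset.2 ⟨α, rfl⟩
      exact ⟨mem_iInter₂.1 hb _ hmem, hbF _ hmem⟩
  have hstep : ∀ (α : ℕ → ZMod 2) m,
      dist (partialProduct g α m) (partialProduct g α (m + 1)) ≤ 1 * (1 / 2 : ℝ) ^ m := by
    intro α m
    rw [partialProduct, one_mul]
    split_ifs
    · simp
    · exact (hg m α).1.le
  have hlim : ∀ α : ℕ → ZMod 2, ∃ x, Tendsto (fun m => partialProduct g α m) atTop (𝓝 x) := fun α =>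
    cauchySeq_tendsto_of_complete (cauchySeq_of_le_geometric _ _ (by norm_num) (hstep α))
  choose φ hφ using hlim
  refine ⟨φ, ?_, ?_⟩
  · have hunif : TendstoUniformly (fun m α => partialProduct g α m) φ atTop := by
      rw [Metric.tendstoUniformly_iff]
      intro ε hε
      have h1 : Tendsto (fun m : ℕ => 1 * (1 / 2 : ℝ) ^ m / (1 - 1 / 2)) atTop (𝓝 0) := by
        have := ((tendsto_pow_atTop_nhds_zero_of_lt_one (r := (1 / 2 : ℝ)) (by norm_num)
          (by norm_num)).const_mul 1).div_const (1 - 1 / 2)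
        simpa using this
      filter_upwards [h1.eventually_lt_const hε] with m hm α
      rw [dist_comm]
      exact (dist_le_of_le_geometric_of_tendsto _ _ (by norm_num) (hstep α) (hφ α) m).trans_lt hm
    exact hunif.continuous (Frequently.of_forall fun m => continuous_partialProduct g m)
  · have hzero : ∀ (α : ℕ → ZMod 2) n, α n = 0 → (φ α)⁻¹ * φ (α + Pi.single n 1) ∉ F := by
      intro α n hα
      have h1 := (hφ α).inv.mul (hφ (α + Pi.single n 1))
      have h2 : Tendsto (fun m => (partialProduct g α m)⁻¹ *
          partialProduct g (α + Pi.single n 1) m) atTop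
          (𝓝 ((partialProduct g α n)⁻¹ * g n * partialProduct g α n)) := by
        refine tendsto_const_nhds.congr' ?_
        filter_upwards [eventually_ge_atTop (n + 1)] with k hk
        exact (inv_partialProduct_mul_partialProduct_add_single g hα hk).symm
      rw [tendsto_nhds_unique h1 h2]
      exact (hg n α).2
    intro α n
    by_cases hα : α n = 0
    · exact hzero α n hα
    -- Flipping is an involution: the quotient is the inverse of the one starting from the flipped
    -- point, whose n-th coordinate is 0.
    · have h1 : ∀ a : ZMod 2, a ≠ 0 → a + 1 = 0 := by decide
      have h2 := hzero (α + Pi.single n 1) n (by simpa using h1 _ hα)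
      have h3 : α + Pi.single n 1 + Pi.single n 1 = α := by
        rw [add_assoc, ← Pi.single_add]
        have : (1 + 1 : ZMod 2) = 0 := by decide
        simp [this]
      rw [h3] at h2
      intro h
      apply h2
      have := F.inv_mem h
      simpa using this

end

/-! ### Universally measurable sets and Haar measure -/

theorem UniversallyMeasurableSet.nullMeasurableSet_preimage {X Y : Type*} [MeasurableSpace X]
    [MeasurableSpace Y] {A : Set Y} (hA : UniversallyMeasurableSet A) {f : X → Y}
    (hf : Measurable f) (μ : Measure X) [IsProbabilityMeasure μ] :
    NullMeasurableSet (f ⁻¹' A) μ :=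
  (hA (μ.map f) (Measure.isProbabilityMeasure_map hf.aemeasurable)).preimage
    ⟨hf, Measure.AbsolutelyContinuous.rfl⟩

theorem UniversallyMeasurableSet.preimage {X Y : Type*} [MeasurableSpace X]
    [MeasurableSpace Y] {A : Set Y} (hA : UniversallyMeasurableSet A) {f : X → Y}
    (hf : Measurable f) : UniversallyMeasurableSet (f ⁻¹' A) :=
  fun μ _ => hA.nullMeasurableSet_preimage hf μ

theorem UniversallyMeasurableSet.iInter {X ι : Type*} [Countable ι] [MeasurableSpace X]
    {A : ι → Set X} (hA : ∀ i, UniversallyMeasurableSet (A i)) :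
    UniversallyMeasurableSet (⋂ i, A i) :=
  fun μ hμ => NullMeasurableSet.iInter fun i => hA i μ hμ

/-- The Haar probability measure of the Cantor group. -/
noncomputable def cantorHaar : Measure (ℕ → ZMod 2) := Measure.addHaarMeasure ⊤

instance : cantorHaar.IsAddHaarMeasure := by unfold cantorHaar; infer_instance

instance : IsProbabilityMeasure cantorHaar :=
  ⟨by
    rw [cantorHaar, ← TopologicalSpace.PositiveCompacts.coe_top]
    exact Measure.addHaarMeasure_self⟩

/-- Two points of the preimage of xF have quotient in F, so they cannot differ by a generator. -/
theorem cantorHaar_preimage_coset_eq_zero {G : Type*} [Group G] [TopologicalSpace G]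
    [IsTopologicalGroup G] [MeasurableSpace G] [BorelSpace G] {F : Subgroup G}
    (hFm : UniversallyMeasurableSet (F : Set G)) {φ : (ℕ → ZMod 2) → G} (hφ : Continuous φ)
    (hφF : ∀ α n, (φ α)⁻¹ * φ (α + Pi.single n 1) ∉ F) (x : G) :
    cantorHaar {α | x⁻¹ * φ α ∈ F} = 0 := by
  refine addHaar_eq_zero_of_forall_add_single_notMem _
    (hFm.nullMeasurableSet_preimage (f := fun α => x⁻¹ * φ α) (by fun_prop) _) ?_
  intro α hα n hn
  apply hφF α n
  have := F.mul_mem (F.inv_mem hα) hn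
  simpa [mul_assoc] using this

/-! ### Consequences of the Cantor group construction -/

section

variable {G : Type*} [Group G] [TopologicalSpace G] [IsTopologicalGroup G]
  [PolishSpace G] [MeasurableSpace G] [BorelSpace G]

/-- A universally measurable subgroup without perfect index has finitely many conjugates covering a
neighbourhood of the identity. -/
theorem exists_nhds_subset_conj_of_not_hasPerfectIndex {F : Subgroup G}
    (hFm : UniversallyMeasurableSet (F : Set G)) (hF : ¬ HasPerfectIndex F) :
    ∃ S : Finset G, ∃ U ∈ 𝓝 (1 : G), ∀ g ∈ U, ∃ s ∈ S, s⁻¹ * g * s ∈ F := by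
  by_contra! hcon
  apply hF
  obtain ⟨φ, hφ, hφF⟩ := exists_continuous_forall_inv_mul_add_single_notMem F hcon
  have hnull : (cantorHaar.prod cantorHaar) {p | (φ p.1)⁻¹ * φ p.2 ∈ F} = 0 := by
    have hm : NullMeasurableSet {p : (ℕ → ZMod 2) × (ℕ → ZMod 2) | (φ p.1)⁻¹ * φ p.2 ∈ F}
        (cantorHaar.prod cantorHaar) :=
      hFm.nullMeasurableSet_preimage
        (f := fun p : (ℕ → ZMod 2) × (ℕ → ZMod 2) => (φ p.1)⁻¹ * φ p.2) (by fun_prop) _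
    -- Fubini is applied to a Borel subset of full measure in the relation; its sections lie in
    -- preimages of cosets.
    obtain ⟨B, hBE, hB, hBe⟩ := hm.exists_measurable_subset_ae_eq
    rw [← measure_congr hBe, Measure.measure_prod_null hB]
    refine Eventually.of_forall fun α => ?_
    exact measure_mono_null (fun β hβ => hBE hβ)
      (cantorHaar_preimage_coset_eq_zero hFm hφ hφF (φ α))
  obtain ⟨e, he⟩ := exists_isClosedEmbedding_cantor_real
  obtain ⟨f, hf, hfE⟩ := exists_continuous_avoiding_of_measure_prod_eq_zero he cantorHaar
    (IsProbabilityMeasure.ne_zero _) hnull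
  have hcont : Continuous fun α => φ (f α) := hφ.comp hf
  have hinj : Function.Injective fun α => φ (f α) := by
    intro α β h
    by_contra hne
    refine hfE α β hne ?_
    have h' : φ (f α) = φ (f β) := h
    simp [h']
  refine ⟨range fun α => φ (f α), range_nonempty _, ⟨(isCompact_range hcont).isClosed, ?_⟩, ?_⟩
  · rintro _ ⟨α, rfl⟩
    have h1 : AccPt α (𝓟 univ) := by
      -- Flipping ever later coordinates approximates α by other points, so the Cantor set has no
      -- isolated points.
      have h2 : Tendsto (fun n => Function.update α n (!α n)) atTop (𝓝[≠] α) := by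
        refine tendsto_nhdsWithin_iff.2 ⟨?_, Eventually.of_forall fun n h => ?_⟩
        · rw [tendsto_pi_nhds]
          intro k
          refine tendsto_const_nhds.congr' ?_
          filter_upwards [eventually_gt_atTop k] with n hn
          rw [Function.update_of_ne hn.ne]
        · have := congrFun h n
          simp at this
      rw [AccPt, principal_univ, inf_top_eq]
      exact h2.neBot
    have h3 := h1.map hcont.continuousAt hinj
    simpa using h3
  · rintro _ ⟨α, rfl⟩ _ ⟨β, rfl⟩ hne
    rw [disjoint_left]
    intro y h1 h2
    refine hfE α β (fun h => hne (by rw [h])) ?_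
    rw [mem_smul_set_iff_inv_smul_mem] at h1 h2
    have := F.mul_mem h1 (F.inv_mem h2)
    simpa [mul_assoc] using this

/-- Conjugates of a normal subgroup coincide, so if N is not open then φ exists and the preimages of
countably many cosets would be null sets covering the Cantor group. -/
theorem isOpen_of_normal_of_countable_quotient {N : Subgroup G} [N.Normal]
    (hNm : UniversallyMeasurableSet (N : Set G)) [Countable (G ⧸ N)] : IsOpen (N : Set G) := by
  refine N.isOpen_of_mem_nhds (g := 1) ?_
  by_contra hN
  obtain ⟨φ, hφ, hφN⟩ := exists_continuous_forall_inv_mul_add_single_notMem N (by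
    intro S U hU
    have : ¬ U ⊆ N := fun h => hN (mem_of_superset hU h)
    obtain ⟨g, hgU, hgN⟩ := not_subset.1 this
    refine ⟨g, hgU, fun s _ hs => hgN ?_⟩
    have := Subgroup.Normal.conj_mem ‹N.Normal› _ hs s
    simpa [mul_assoc] using this)
  have h1 : (⋃ q : G ⧸ N, {α | (q.out)⁻¹ * φ α ∈ N}) = univ := by
    refine eq_univ_of_forall fun α => mem_iUnion.2 ⟨(φ α : G ⧸ N), ?_⟩
    exact QuotientGroup.eq.1 (QuotientGroup.out_eq' _)
  have h2 : cantorHaar (⋃ q : G ⧸ N, {α | (q.out)⁻¹ * φ α ∈ N}) = 0 :=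
    measure_iUnion_null fun q => cantorHaar_preimage_coset_eq_zero hNm hφ hφN _
  rw [h1] at h2
  simp at h2

end

/-! ### Neumann's lemma and finite index in the closure -/

/-- A local form of Neumann's lemma: if a neighbourhood of the identity is covered by finitely many
cosets of finitely many subgroups, then some neighbourhood of the identity is covered by finitely many
cosets of one of these subgroups. -/
theorem exists_nhds_subset_finite_cosets {G ι : Type*} [Group G] [TopologicalSpace G]
    [IsTopologicalGroup G] (H : ι → Subgroup G) (I : Finset ι) :
    ∀ (A : Set G) (V : Set G), A.Finite → V ∈ 𝓝 (1 : G) →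
      (∀ v ∈ V, ∃ i ∈ I, ∃ a ∈ A, a⁻¹ * v ∈ H i) →
      ∃ i ∈ I, ∃ B : Set G, B.Finite ∧ ∃ W ∈ 𝓝 (1 : G), ∀ w ∈ W, ∃ b ∈ B, b⁻¹ * w ∈ H i := by
  classical
  induction I using Finset.induction_on with
  | empty =>
    intro A V _ hV h
    obtain ⟨i, hi, -⟩ := h 1 (mem_of_mem_nhds hV)
    simp at hi
  | insert i₀ I _ ih =>
    intro A V hA hV h
    obtain ⟨W, hW, hWV⟩ : ∃ W ∈ 𝓝 (1 : G), ∀ x ∈ W, ∀ y ∈ W, ∀ z ∈ W, x * y⁻¹ * z ∈ V := by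
      have hc : Tendsto (fun p : G × G × G => p.1 * p.2.1⁻¹ * p.2.2) (𝓝 (1, 1, 1)) (𝓝 1) := by
        have : Continuous fun p : G × G × G => p.1 * p.2.1⁻¹ * p.2.2 := by fun_prop
        simpa using this.tendsto (1, 1, 1)
      have hV' := hc hV
      rw [nhds_prod_eq, nhds_prod_eq, mem_map, mem_prod_iff] at hV'
      obtain ⟨W₁, hW₁, T, hT, hWT⟩ := hV'
      obtain ⟨W₂, hW₂, W₃, hW₃, hT'⟩ := mem_prod_iff.1 hT
      refine ⟨W₁ ∩ (W₂ ∩ W₃), inter_mem hW₁ (inter_mem hW₂ hW₃), fun x hx y hy z hz => ?_⟩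
      exact hWT (show (x, y, z) ∈ W₁ ×ˢ T from ⟨hx.1, hT' ⟨hy.2.1, hz.2.2⟩⟩)
    by_cases hcov : ∀ w ∈ W, ∃ a ∈ A, a⁻¹ * w ∈ H i₀
    · exact ⟨i₀, by simp, A, hA, W, hW, hcov⟩
    · push Not at hcov
      obtain ⟨x, hxW, hx⟩ := hcov
      -- x lies in W but in no coset a H i₀, and c a is a representative of a H i₀ in W when there
      -- is one. For w in a H i₀ ∩ W, the element x (c a)⁻¹ w of V lies in x H i₀, so its coset a' H
      -- j has j ≠ i₀; hence w lies in c a x⁻¹ a' H j.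
      choose! c hc using fun (a : G) (h : ∃ w ∈ W, a⁻¹ * w ∈ H i₀) => h
      obtain ⟨i, hi, hB⟩ := ih (A ∪ Set.image2 (fun a a' => c a * x⁻¹ * a') A A) W
        (hA.union (hA.image2 _ hA)) hW (by
          intro w hw
          have hwV : w ∈ V := by
            have := hWV w hw w hw w hw
            simpa using this
          obtain ⟨i, hi, a, ha, haw⟩ := h w hwV
          rcases Finset.mem_insert.1 hi with rfl | hi
          · obtain ⟨hcW, hcH⟩ := hc a ⟨w, hw, haw⟩
            have hcw : (c a)⁻¹ * w ∈ H i := by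
              have := (H i).mul_mem ((H i).inv_mem hcH) haw
              simpa [mul_assoc] using this
            obtain ⟨j, hj, a', ha', hja⟩ := h _ (hWV x hxW (c a) hcW w hw)
            rcases Finset.mem_insert.1 hj with rfl | hj
            · refine absurd ?_ (hx a' ha')
              have := (H j).mul_mem hja ((H j).inv_mem hcw)
              simpa [mul_assoc] using this
            · refine ⟨j, hj, _, Or.inr ⟨a, ha, a', ha', rfl⟩, ?_⟩
              simpa [mul_assoc] using hja
          · exact ⟨i, hi, a, Or.inl ha, haw⟩)
      exact ⟨i, Finset.mem_insert_of_mem hi, hB⟩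

section

variable {G : Type*} [Group G] [TopologicalSpace G] [IsTopologicalGroup G]

theorem exists_nhds_subset_finite_cosets_of_subset_conj {F : Subgroup G} {S : Finset G} {U : Set G}
    (hU : U ∈ 𝓝 (1 : G)) (h : ∀ g ∈ U, ∃ s ∈ S, s⁻¹ * g * s ∈ F) :
    ∃ B : Set G, B.Finite ∧ ∃ W ∈ 𝓝 (1 : G), ∀ w ∈ W, ∃ b ∈ B, b⁻¹ * w ∈ F := by
  obtain ⟨s, -, B, hB, W, hW, hWB⟩ := exists_nhds_subset_finite_cosets
    (fun s : G => F.comap (MulAut.conj s⁻¹).toMonoidHom) S {1} U (finite_singleton 1) hU (by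
      intro g hg
      obtain ⟨s, hs, hsg⟩ := h g hg
      exact ⟨s, hs, 1, rfl, by simpa [mul_assoc] using hsg⟩)
  refine ⟨(fun b => s⁻¹ * b * s) '' B, hB.image _, (fun w => s * w * s⁻¹) ⁻¹' W, ?_, ?_⟩
  · have : Continuous fun w : G => s * w * s⁻¹ := by fun_prop
    exact this.continuousAt.preimage_mem_nhds (by simpa using hW)
  · intro w hw
    obtain ⟨b, hb, hbw⟩ := hWB _ hw
    exact ⟨_, ⟨b, hb, rfl⟩, by simpa [mul_assoc] using hbw⟩

/-- If finitely many cosets of `F` cover a neighbourhood of the identity, then the closure of `F` is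
open. -/
theorem isOpen_topologicalClosure_of_finite_cosets {F : Subgroup G} {B W : Set G} (hB : B.Finite)
    (hW : W ∈ 𝓝 (1 : G)) (h : ∀ w ∈ W, ∃ b ∈ B, b⁻¹ * w ∈ F) :
    IsOpen (F.topologicalClosure : Set G) := by
  refine Subgroup.isOpen_of_mem_nhds (g := 1) _ ?_
  have hcl : ∀ b : G, IsClosed {g | b⁻¹ * g ∈ F.topologicalClosure} := fun b =>
    F.isClosed_topologicalClosure.preimage (continuous_const_mul b⁻¹)
  -- The cosets of the closure that miss 1 are finitely many closed sets, so a neighbourhood of 1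
  -- avoids them all.
  have hbig : (⋂ b ∈ {b ∈ B | b ∉ F.topologicalClosure},
      {g | b⁻¹ * g ∈ F.topologicalClosure}ᶜ) ∈ 𝓝 (1 : G) := by
    rw [biInter_mem (hB.subset (sep_subset _ _))]
    intro b hb
    exact (hcl b).isOpen_compl.mem_nhds (by simpa using hb.2)
  filter_upwards [hW, hbig] with w hw hw2
  obtain ⟨b, hb, hbw⟩ := h w hw
  have hbw' := F.le_topologicalClosure hbw
  have hbK : b ∈ F.topologicalClosure := by
    by_contra hbK
    exact mem_iInter₂.1 hw2 b ⟨hb, hbK⟩ hbw'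
  have := F.topologicalClosure.mul_mem hbK hbw'
  rwa [mul_inv_cancel_left] at this

/-- An f in F close to k has k f⁻¹ in W, and k lies in the same left coset as k f⁻¹. -/
theorem exists_mem_finite_coset_of_mem_topologicalClosure {F : Subgroup G} {B W : Set G}
    (hW : W ∈ 𝓝 (1 : G)) (h : ∀ w ∈ W, ∃ b ∈ B, b⁻¹ * w ∈ F) {k : G}
    (hk : k ∈ F.topologicalClosure) : ∃ b ∈ B, b⁻¹ * k ∈ F := by
  have hn : {x | k * x⁻¹ ∈ W} ∈ 𝓝 k := by
    have : Continuous fun x : G => k * x⁻¹ := by fun_prop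
    exact this.continuousAt.preimage_mem_nhds (by simpa using hW)
  obtain ⟨f, hfW, hfF⟩ := mem_closure_iff_nhds.1 hk _ hn
  obtain ⟨b, hb, hbk⟩ := h _ hfW
  refine ⟨b, hb, ?_⟩
  have := F.mul_mem hbk hfF
  simpa [mul_assoc] using this

end

/-! ### Openness, countable index and automatic continuity -/

theorem HasPerfectIndex.not_countable_quotient {G : Type*} [Group G] [TopologicalSpace G]
    [PolishSpace G] {F : Subgroup G} (hF : HasPerfectIndex F) :
    ¬ Countable (G ⧸ F) := by
  intro hc
  let _ := TopologicalSpace.upgradeIsCompletelyMetrizable G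
  obtain ⟨C, hne, hC, hdisj⟩ := hF
  obtain ⟨f, hfC, -, hfi⟩ := hC.exists_nat_bool_injection hne
  have hinj : Function.Injective fun α => (f α : G ⧸ F) := by
    intro α β h
    by_contra hαβ
    have hd := hdisj (f α) (hfC ⟨α, rfl⟩) (f β) (hfC ⟨β, rfl⟩) fun h => hαβ (hfi h)
    have h1 : f β ∈ f α • (F : Set G) := by
      rw [mem_smul_set_iff_inv_smul_mem]
      exact QuotientGroup.eq.1 h
    have h2 : f β ∈ f β • (F : Set G) := by
      rw [mem_smul_set_iff_inv_smul_mem]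
      simp
    exact disjoint_left.1 hd h1 h2
  have h1 : Cardinal.mk (ℕ → Bool) = Cardinal.continuum := by simp
  have : Countable (ℕ → Bool) := hinj.countable
  exact absurd (h1 ▸ Cardinal.mk_le_aleph0_iff.2 this) (not_le.2 Cardinal.aleph0_lt_continuum)

section

variable {G : Type*} [Group G] [TopologicalSpace G] [IsTopologicalGroup G]
  [PolishSpace G] [MeasurableSpace G] [BorelSpace G]

theorem isOpen_of_finiteIndex {F : Subgroup G} (hFm : UniversallyMeasurableSet (F : Set G))
    [F.FiniteIndex] : IsOpen (F : Set G) := by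
  have : Finite (G ⧸ F) := Subgroup.finite_quotient_of_finiteIndex
  -- The core is the kernel of the action on G / F, hence a finite intersection of conjugates of F.
  have hcore : (F.normalCore : Set G) =
      ⋂ q : G ⧸ F, (fun g => q.out⁻¹ * g * q.out) ⁻¹' (F : Set G) := by
    ext g
    simp only [Subgroup.normalCore_eq_ker, SetLike.mem_coe, MonoidHom.mem_ker, mem_iInter,
      mem_preimage, Equiv.ext_iff, MulAction.toPermHom_apply, MulAction.toPerm_apply,
      Equiv.Perm.one_apply]
    refine forall_congr' fun q => ?_
    conv_lhs => rw [← QuotientGroup.out_eq' q]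
    rw [MulAction.Quotient.smul_coe, eq_comm, QuotientGroup.eq, smul_eq_mul, mul_assoc]
  have hm : UniversallyMeasurableSet (F.normalCore : Set G) := by
    rw [hcore]
    refine UniversallyMeasurableSet.iInter fun q => hFm.preimage (Continuous.measurable ?_)
    fun_prop
  have := isOpen_of_normal_of_countable_quotient hm
  exact Subgroup.isOpen_mono F.normalCore_le this

theorem isOpen_of_finite_cosets {F : Subgroup G} (hFm : UniversallyMeasurableSet (F : Set G))
    {B W : Set G} (hB : B.Finite) (hW : W ∈ 𝓝 (1 : G)) (h : ∀ w ∈ W, ∃ b ∈ B, b⁻¹ * w ∈ F) :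
    IsOpen (F : Set G) := by
  have hKo := isOpen_topologicalClosure_of_finite_cosets hB hW h
  have hcov := fun k (hk : k ∈ F.topologicalClosure) =>
    exists_mem_finite_coset_of_mem_topologicalClosure hW h hk
  have hle := F.le_topologicalClosure
  generalize F.topologicalClosure = K at hKo hcov hle
  have : PolishSpace K := hKo.polishSpace
  have hBf : Finite B := hB
  choose c hcB hc using hcov
  -- A coset of F in K is determined by the element of B chosen for its representative.
  have : Finite (K ⧸ F.subgroupOf K) := by
    refine Finite.of_injective
      (fun q : K ⧸ F.subgroupOf K => (⟨c q.out q.out.2, hcB _ _⟩ : B)) fun q r hqr => ?_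
    have h1 := hc q.out q.out.2
    have h2 := hc r.out r.out.2
    have h3 : c q.out q.out.2 = c r.out r.out.2 := congrArg Subtype.val hqr
    rw [h3] at h1
    rw [← QuotientGroup.out_eq' q, ← QuotientGroup.out_eq' r, QuotientGroup.eq,
      Subgroup.mem_subgroupOf]
    have := F.mul_mem (F.inv_mem h1) h2
    simpa [mul_assoc] using this
  have : (F.subgroupOf K).FiniteIndex := Subgroup.finiteIndex_of_finite_quotient
  have hopen := isOpen_of_finiteIndex (F := F.subgroupOf K) (hFm.preimage measurable_subtype_coe)
  have himg : (F : Set G) = Subtype.val '' (F.subgroupOf K : Set K) := by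
    ext g
    constructor
    · exact fun hg => ⟨⟨g, hle hg⟩, hg, rfl⟩
    · rintro ⟨k, hk, rfl⟩
      exact hk
  rw [himg]
  exact hKo.isOpenMap_subtype_val _ hopen

theorem isOpen_or_hasPerfectIndex {F : Subgroup G}
    (hFm : UniversallyMeasurableSet (F : Set G)) : IsOpen (F : Set G) ∨ HasPerfectIndex F := by
  refine or_iff_not_imp_right.2 fun hF => ?_
  obtain ⟨S, U, hU, hUS⟩ := exists_nhds_subset_conj_of_not_hasPerfectIndex hFm hF
  obtain ⟨B, hB, W, hW, h⟩ := exists_nhds_subset_finite_cosets_of_subset_conj hU hUS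
  exact isOpen_of_finite_cosets hFm hB hW h

theorem isOpen_of_countable_quotient {F : Subgroup G}
    (hFm : UniversallyMeasurableSet (F : Set G)) (hF : Countable (G ⧸ F)) : IsOpen (F : Set G) :=
  (isOpen_or_hasPerfectIndex hFm).resolve_right fun h => h.not_countable_quotient hF

theorem continuous_of_universallyMeasurableMap (π : G →* Equiv.Perm ℕ)
    (hπ : UniversallyMeasurableMap π) : Continuous π := by
  have hbasic : ∀ n m : ℕ, IsOpen {g : Equiv.Perm ℕ | g n = m} := fun n m =>
    TopologicalSpace.isOpen_generateFrom_of_mem ⟨{n}, fun _ => m, by simp⟩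
  have hstab : ∀ n, IsOpen {x : G | π x n = n} := by
    intro n
    let F : Subgroup G := (MulAction.stabilizer (Equiv.Perm ℕ) n).comap π
    have hF : (F : Set G) = {x : G | π x n = n} := rfl
    have hFm : UniversallyMeasurableSet (F : Set G) := hπ _ (hbasic n n)
    rw [← hF]
    refine isOpen_of_countable_quotient hFm ?_
    -- Cosets of the stabilizer of n correspond to points of its orbit in ℕ.
    refine Function.Injective.countable (f := fun q : G ⧸ F => π q.out n) fun q r hqr => ?_
    rw [← QuotientGroup.out_eq' q, ← QuotientGroup.out_eq' r, QuotientGroup.eq]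
    change π (q.out⁻¹ * r.out) n = n
    have hqr' : π q.out n = π r.out n := hqr
    rw [map_mul, map_inv, Equiv.Perm.mul_apply, ← hqr']
    simp
  have hcoset : ∀ n m, IsOpen {x : G | π x n = m} := by
    intro n m
    rw [isOpen_iff_mem_nhds]
    intro y hy
    have h1 : {x | π (y⁻¹ * x) n = n} ∈ 𝓝 y :=
      (continuous_const_mul y⁻¹).continuousAt.preimage_mem_nhds
        ((hstab n).mem_nhds (by simp))
    filter_upwards [h1] with x hx
    have h2 : π (y * (y⁻¹ * x)) n = π y n := by
      rw [map_mul, Equiv.Perm.mul_apply]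
      exact congrArg _ hx
    rw [mul_inv_cancel_left] at h2
    exact h2.trans hy
  refine continuous_generateFrom_iff.2 ?_
  rintro _ ⟨s, m, rfl⟩
  have : π ⁻¹' {g : Equiv.Perm ℕ | ∀ n ∈ s, g n = m n} = ⋂ n ∈ s, {x | π x n = m n} := by
    ext x; simp
  rw [this]
  exact isOpen_biInter_finset fun n _ => hcoset n (m n)

end

theorem theorem1 {G : Type*} [Group G] [TopologicalSpace G] [IsTopologicalGroup G]
    [PolishSpace G] [MeasurableSpace G] [BorelSpace G] :
    (∀ F : Subgroup G, UniversallyMeasurableSet (F : Set G) →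
      IsOpen (F : Set G) ∨ HasPerfectIndex F) ∧
    (∀ F : Subgroup G, UniversallyMeasurableSet (F : Set G) → Countable (G ⧸ F) →
      IsOpen (F : Set G)) ∧
    (∀ π : G →* Equiv.Perm ℕ, UniversallyMeasurableMap π → Continuous π) :=
  ⟨fun _ hF => isOpen_or_hasPerfectIndex hF, fun _ hF hc => isOpen_of_countable_quotient hF hc,
    fun π hπ => continuous_of_universallyMeasurableMap π hπ⟩
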